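/- All Hilbert spaces are complex, finite-dimensional and non-zero; for a set $R$ of systems, $\mathcal H_R=\bigotimes_{X\in R}\mathcal H_X$ (so $\mathcal H_\emptyset=\mathbb C$). For a linear map $\mathcal C:\mathcal L(\mathcal H_X)\to\mathcal L(\mathcal H_Y)$ let $\rho^{\mathcal C}_{Y|X}=\sum_{i,j}\mathcal C(|i\rangle\langle j|)\otimes|i\rangle\langle j|$ be its Choi–Jamiołkowski operator on $\mathcal H_Y\otimes\mathcal H_X^*$, and for a unitary $U$ write $\rho^U$ for that of the channel $\rho\mapsto U\rho U^\dagger$. Let $U:\mathcal H_{A_1}\otimes\dots\otimes\mathcal H_{A_n}\to\mathcal H_{B_1}\otimes\dots\otimes\mathcal H_{B_k}$ be unitary. For a set $P$ of inputs with complement $\overline P$ and a set $Q$ of outputs with complement $\overline Q$, write $P\nrightarrow Q$ ($P$ does not influence $Q$ in $U$) if there is a quantum channel (completely positive trace-preserving map) $\mathcal M:\mathcal L(\mathcal H_{\overline P})\to\mathcal L(\mathcal H_Q)$ with $\mathrm{Tr}_{\overline Q}\,\rho^U_{\overline Q Q|P\overline P}=\rho^{\mathcal M}_{Q|\overline P}\otimes\mathbb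 1_{P^*}$. (1) Let $\{B_1,\dots,B_k\}=S\cup\overline S$ be any bipartition of the outputs and $\{A_1,\dots,A_n\}=P_S\cup C\cup P_{\overline S}$ any partition of the inputs into three disjoint (possibly empty) subsets such that $P_S\nrightarrow\overline S$ and $P_{\overline S}\nrightarrow S$. Then there exist Hilbert spaces $\mathcal H_{X^L},\mathcal H_{X^R}$ and unitaries $T:\mathcal H_C\to\mathcal H_{X^L}\otimes\mathcal H_{X^R}$, $V:\mathcal H_{P_S}\otimes\mathcal H_{X^L}\to\mathcal H_S$ and $W:\mathcal H_{X^R}\otimes\mathcal H_{P_{\overline S}}\to\mathcal H_{\overline S}$ such that $$U=(V\otimes W)\,(\mathbb 1_{P_S}\otimes T\otimes\mathbb 1_{P_{\overline S}}).$$ (2) An (ordinary) circuit diagram is built by sequential and parallel composition from boxes, each carrying a unitary from the tensor product of its finitely many (possibly zero) input wires to that of its finitely many (possibly zero) output wires, and from bare wires, which may cross; it represents the corresponding composition of linear maps. A path may enter a box by any of its input wires and leave it by any of its output wires. If $k=2$, then for every $n$ there is a circuit diagram representing $U$ that is causally faithful: for all $i,j$, there is no path in the diagram from $A_i$ to $B_j$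 if and only if $\{A_i\}\nrightarrow\{B_j\}$ in $U$. -/

import Mathlib

open scoped Matrix Kronecker ComplexOrder

namespace UnitaryCausality

/-! A quantum system of finite dimension `d` has Hilbert space `ℂ^d`, with computational basis
`Fin d`.  A family of systems with dimensions `d : ι → ℕ` has Hilbert space the tensor product of
the `ℂ^(d i)`, whose product basis is indexed by `Cfg d`.  Linear maps are matrices in these
orthonormal bases. -/

/-- Labels of the product basis of `⨂ i, ℂ^(d i)`. -/
abbrev Cfg {ι : Type} (d : ι → ℕ) : Type := ∀ i, Fin (d i)

/-- The dimensions of the subfamily of systems indexed by `P`. -/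
abbrev sub {ι : Type} (d : ι → ℕ) (P : Finset ι) : P → ℕ := fun i => d i

/-- The part of a product basis label that belongs to the systems in `P`. -/
def res {ι : Type} {d : ι → ℕ} (P : Finset ι) (x : Cfg d) : Cfg (sub d P) := fun i => x i

/-- The basis label assembled from its part in `P` and its part outside `P`; this realizes the
canonical identification `H_P ⊗ H_{Pᶜ} = ⨂ i, ℂ^(d i)`. -/
def glue {ι : Type} [Fintype ι] [DecidableEq ι] {d : ι → ℕ} (P : Finset ι)
    (x : Cfg (sub d P)) (y : Cfg (sub d Pᶜ)) : Cfg d :=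
  fun i => if h : i ∈ P then x ⟨i, h⟩ else y ⟨i, Finset.mem_compl.2 h⟩

/-- A unitary transformation between (possibly differently labelled) Hilbert spaces. -/
def IsUnitary {m n : Type} [Fintype m] [Fintype n] [DecidableEq m] [DecidableEq n]
    (U : Matrix m n ℂ) : Prop :=
  Uᴴ * U = 1 ∧ U * Uᴴ = 1

section Channels

variable {m n : Type} [Fintype m] [Fintype n]

/-- `Φ` is completely positive: `id_k ⊗ Φ` preserves positive semidefiniteness for all `k`. -/
def IsCompletelyPositive (Φ : Matrix m m ℂ →ₗ[ℂ] Matrix n n ℂ) : Prop :=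
  ∀ (k : ℕ) (R : Matrix (Fin k × m) (Fin k × m) ℂ), R.PosSemidef →
    (Matrix.of fun p q : Fin k × n =>
      Φ (Matrix.of fun i j : m => R (p.1, i) (q.1, j)) p.2 q.2).PosSemidef

/-- A quantum channel: a completely positive trace-preserving map. -/
def IsChannel (Φ : Matrix m m ℂ →ₗ[ℂ] Matrix n n ℂ) : Prop :=
  IsCompletelyPositive Φ ∧ ∀ X, (Φ X).trace = X.trace

/-- The Choi-Jamiolkowski operator `∑ i j, Φ(|i⟩⟨j|) ⊗ |i⟩⟨j|` on (output) ⊗ (dual of input). -/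
def choi [DecidableEq m] (Φ : Matrix m m ℂ →ₗ[ℂ] Matrix n n ℂ) : Matrix (n × m) (n × m) ℂ :=
  ∑ i, ∑ j, Φ (Matrix.single i j 1) ⊗ₖ Matrix.single i j 1

/-- The map `X ↦ U X U†`. -/
def conjBy (U : Matrix n m ℂ) : Matrix m m ℂ →ₗ[ℂ] Matrix n n ℂ where
  toFun X := U * X * Uᴴ
  map_add' X Y := by rw [Matrix.mul_add, Matrix.add_mul]
  map_smul' c X := by simp

end Channels

/-- For `U : A ⊗ C → B ⊗ D`, the relation "`A` does not influence `D`": there is a channel `M`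
from `C` to `D` with `Tr_B ρ^U_{BD|AC} = ρ^M_{D|C} ⊗ 1_{A*}`.  An index of either side is a
label of `D` together with one of `A` and one of `C`. -/
def NoInfluenceBip {α β γ δ : Type} [Fintype α] [Fintype β] [Fintype γ] [Fintype δ]
    [DecidableEq α] [DecidableEq γ] (U : Matrix (β × δ) (α × γ) ℂ) : Prop :=
  ∃ M : Matrix γ γ ℂ →ₗ[ℂ] Matrix δ δ ℂ, IsChannel M ∧
    (Matrix.of fun p q : δ × (α × γ) => ∑ b : β, choi (conjBy U) ((b, p.1), p.2) ((b, q.1), q.2)) =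
    (choi M ⊗ₖ (1 : Matrix α α ℂ)).submatrix
      (fun p : δ × (α × γ) => ((p.1, p.2.2), p.2.1)) (fun q => ((q.1, q.2.2), q.2.1))

/-- `P ↛ Q` for a set `P` of inputs and a set `Q` of outputs of `U`. -/
def NoInfluence {ι κ : Type} [Fintype ι] [DecidableEq ι] [Fintype κ] [DecidableEq κ]
    {a : ι → ℕ} {b : κ → ℕ} (U : Matrix (Cfg b) (Cfg a) ℂ) (P : Finset ι) (Q : Finset κ) : Prop :=
  NoInfluenceBip (α := Cfg (sub a P)) (β := Cfg (sub b Qᶜ))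
    (γ := Cfg (sub a Pᶜ)) (δ := Cfg (sub b Q))
    (U.submatrix (fun p => glue Q p.2 p.1) (fun p => glue P p.1 p.2))

/-- Basis labels of `(p ⊗ l) ⊗ (r ⊗ q)` read as labels of `p ⊗ ((l ⊗ r) ⊗ q)`. -/
def regroup {p l r q : Type} (z : (p × l) × (r × q)) : p × ((l × r) × q) :=
  (z.1.1, ((z.1.2, z.2.1), z.2.2))

/-- The operator `(V ⊗ W) (1 ⊗ T ⊗ 1)`. -/
def compVWT {s t p c q l r : Type} [Fintype p] [Fintype l] [Fintype r] [Fintype q]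
    [DecidableEq p] [DecidableEq q]
    (V : Matrix s (p × l) ℂ) (W : Matrix t (r × q) ℂ) (T : Matrix (l × r) c ℂ) :
    Matrix (s × t) (p × (c × q)) ℂ :=
  (V ⊗ₖ W) * ((1 : Matrix p p ℂ) ⊗ₖ (T ⊗ₖ (1 : Matrix q q ℂ))).submatrix regroup id

/-! ### Circuit diagrams -/

/-- A finite bundle of wires, each carrying a system of a given dimension. -/
structure Wires where
  label : Type
  [fintypeLabel : Fintype label]
  [decEqLabel : DecidableEq label]
  dim : label → ℕ

attribute [instance] Wires.fintypeLabel Wires.decEqLabel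

/-- Two bundles side by side. -/
abbrev Wires.par (a b : Wires) : Wires := ⟨a.label ⊕ b.label, Sum.elim a.dim b.dim⟩

/-- Ordinary circuit diagrams of unitary boxes, from the input wires `a` to the output wires `b`:
single boxes, bare (possibly permuted) wires, and their sequential and parallel compositions. -/
inductive Circuit : Wires → Wires → Type 1
  | box {a b : Wires} (U : Matrix (Cfg b.dim) (Cfg a.dim) ℂ) (hU : IsUnitary U) : Circuit a b
  | bare {a b : Wires} (e : b.label ≃ a.label) (h : ∀ j, b.dim j = a.dim (e j)) : Circuit a b
  | seq {a b c : Wires} (f : Circuit a b) (g : Circuit b c) : Circuit a c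
  | par {a b a' b' : Wires} (f : Circuit a b) (g : Circuit a' b') :
      Circuit (a.par a') (b.par b')

/-- The linear map that a circuit diagram represents. -/
def Circuit.toMatrix : {a b : Wires} → Circuit a b → Matrix (Cfg b.dim) (Cfg a.dim) ℂ
  | _, _, .box U _ => U
  | _, _, .bare e _ => Matrix.of fun y x => if ∀ j, (y j : ℕ) = (x (e j) : ℕ) then 1 else 0
  | _, _, .seq f g => g.toMatrix * f.toMatrix
  | _, _, .par f g => (f.toMatrix ⊗ₖ g.toMatrix).submatrix
      (fun y => (fun j => y (Sum.inl j), fun j => y (Sum.inr j)))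
      (fun x => (fun i => x (Sum.inl i), fun i => x (Sum.inr i)))

/-- There is a path in the diagram from the input wire `i` to the output wire `j`.  Every input
of a box is connected with every output of the same box. -/
def Circuit.HasPath : {a b : Wires} → Circuit a b → a.label → b.label → Prop
  | _, _, .box _ _, _, _ => True
  | _, _, .bare e _, i, j => e j = i
  | _, _, .seq f g, i, j => ∃ k, f.HasPath i k ∧ g.HasPath k j
  | _, _, .par f _, .inl i, .inl j => f.HasPath i j
  | _, _, .par _ g, .inr i, .inr j => g.HasPath i j
  | _, _, .par _ _, .inl _, .inr _ => False
  | _, _, .par _ _, .inr _, .inl _ => False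

/-- The diagram has no path from an input to an output exactly if, in the represented map, that
input does not influence that output. -/
def Circuit.CausallyFaithful {a b : Wires} (c : Circuit a b) : Prop :=
  ∀ i j, ¬ c.HasPath i j ↔ NoInfluence c.toMatrix {i} {j}

end UnitaryCausality

open UnitaryCausality

namespace UnitaryCausality

section Unitary

variable {m n m' n' : Type} [Fintype m] [Fintype n] [Fintype m'] [Fintype n']
  [DecidableEq m] [DecidableEq n] [DecidableEq m'] [DecidableEq n']

theorem IsUnitary.submatrix {U : Matrix m n ℂ} (hU : IsUnitary U) (e : m' ≃ m) (f : n' ≃ n) :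
    IsUnitary (U.submatrix e f) := by
  constructor
  · rw [Matrix.conjTranspose_submatrix, Matrix.submatrix_mul_equiv, hU.1,
      Matrix.submatrix_one_equiv]
  · rw [Matrix.conjTranspose_submatrix, Matrix.submatrix_mul_equiv, hU.2,
      Matrix.submatrix_one_equiv]

theorem IsUnitary.conjTranspose {U : Matrix m n ℂ} (hU : IsUnitary U) : IsUnitary Uᴴ := by
  simpa [IsUnitary, and_comm] using hU

theorem IsUnitary.mul {k : Type} [Fintype k] [DecidableEq k] {U : Matrix m n ℂ} {V : Matrix n k ℂ}
    (hU : IsUnitary U) (hV : IsUnitary V) : IsUnitary (U * V) := by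
  constructor
  · rw [Matrix.conjTranspose_mul, Matrix.mul_assoc, ← Matrix.mul_assoc Uᴴ, hU.1, Matrix.one_mul,
      hV.1]
  · rw [Matrix.conjTranspose_mul, Matrix.mul_assoc, ← Matrix.mul_assoc V, hV.2, Matrix.one_mul,
      hU.2]

theorem IsUnitary.kronecker {U : Matrix m n ℂ} {V : Matrix m' n' ℂ} (hU : IsUnitary U)
    (hV : IsUnitary V) : IsUnitary (U ⊗ₖ V) := by
  constructor <;> rw [Matrix.conjTranspose_kronecker, ← Matrix.mul_kronecker_mul]
  · rw [hU.1, hV.1, Matrix.one_kronecker_one]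
  · rw [hU.2, hV.2, Matrix.one_kronecker_one]

theorem isUnitary_one : IsUnitary (1 : Matrix m m ℂ) := by simp [IsUnitary]

theorem isUnitary_of_one_kronecker [Nonempty n'] {U : Matrix m n ℂ}
    (hU : IsUnitary ((1 : Matrix n' n' ℂ) ⊗ₖ U)) : IsUnitary U := by
  obtain ⟨o⟩ := ‹Nonempty n'›
  obtain ⟨h1, h2⟩ := hU
  rw [Matrix.conjTranspose_kronecker, ← Matrix.mul_kronecker_mul, Matrix.conjTranspose_one,
    Matrix.mul_one] at h1 h2
  constructor
  · ext i j
    simpa [Matrix.one_apply] using congrFun (congrFun h1 (o, i)) (o, j)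
  · ext i j
    simpa [Matrix.one_apply] using congrFun (congrFun h2 (o, i)) (o, j)

end Unitary

/-- An orthogonal projection is `K Kᴴ` for an isometry `K`. -/
theorem exists_isometry_of_projection {n : Type} [Fintype n] [DecidableEq n]
    {p : Matrix n n ℂ} (hp : pᴴ = p) (hpp : p * p = p) :
    ∃ (l : ℕ) (K : Matrix n (Fin l) ℂ), Kᴴ * K = 1 ∧ K * Kᴴ = p := by
  have hH : p.IsHermitian := hp
  obtain ⟨l, ⟨e⟩⟩ : ∃ l, Nonempty (Fin l ≃ {i // hH.eigenvalues i = 1}) :=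
    ⟨_, ⟨(Fintype.equivFin _).symm⟩⟩
  set O : Matrix n n ℂ := (hH.eigenvectorUnitary : Matrix n n ℂ) with hO
  have hO1 : Oᴴ * O = 1 := by
    have := hH.eigenvectorUnitary.2
    exact (Matrix.mem_unitaryGroup_iff'.1 this)
  set D : Matrix n n ℂ := Matrix.diagonal (fun i => (hH.eigenvalues i : ℂ)) with hD
  have hspec : p = O * D * Oᴴ := by
    have := hH.spectral_theorem
    simpa [Unitary.conjStarAlgAut_apply, Function.comp_def, hO, hD,
      Matrix.star_eq_conjTranspose] using this
  have hDD : D * D = D := by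
    have h1 : D = Oᴴ * p * O := by
      rw [hspec]
      calc D = (Oᴴ * O) * D * (Oᴴ * O) := by rw [hO1]; simp
        _ = _ := by simp only [Matrix.mul_assoc]
    have hO2 : O * Oᴴ = 1 := mul_eq_one_comm.1 hO1
    calc D * D = Oᴴ * (p * (O * Oᴴ) * p) * O := by rw [h1]; simp only [Matrix.mul_assoc]
      _ = D := by rw [hO2, Matrix.mul_one, hpp, h1]
  have hev : ∀ i, hH.eigenvalues i = 0 ∨ hH.eigenvalues i = 1 := by
    intro i
    have h := congrFun (congrFun hDD i) i
    simp only [hD, Matrix.diagonal_mul_diagonal, Matrix.diagonal_apply_eq] at h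
    have h' : hH.eigenvalues i * hH.eigenvalues i = hH.eigenvalues i := by exact_mod_cast h
    rcases eq_or_ne (hH.eigenvalues i) 0 with h0 | h0
    · exact Or.inl h0
    · exact Or.inr (mul_right_cancel₀ h0 (by simpa using h'))
  refine ⟨l, O.submatrix id (fun k => (e k).1), ?_, ?_⟩
  · ext k k'
    have h := congrFun (congrFun hO1 (e k).1) (e k').1
    rw [Matrix.mul_apply] at h ⊢
    simp only [Matrix.conjTranspose_apply, Matrix.submatrix_apply, id] at h ⊢
    rw [h, Matrix.one_apply, Matrix.one_apply]
    simp [← Subtype.ext_iff]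
  · ext i j
    have h := congrFun (congrFun hspec i) j
    rw [Matrix.mul_apply] at h ⊢
    simp only [Matrix.conjTranspose_apply, Matrix.submatrix_apply, id, hD, Matrix.mul_diagonal]
      at h ⊢
    rw [h, Equiv.sum_comp e (fun k : {i // hH.eigenvalues i = 1} => O i k.1 * star (O j k.1)),
      ← Finset.sum_subtype (Finset.univ.filter fun k => hH.eigenvalues k = 1) (by simp)
        (fun k => O i k * star (O j k)), Finset.sum_filter]
    refine Finset.sum_congr rfl fun k _ => ?_
    rcases hev k with h0 | h0 <;> simp [h0]

/-- A system of matrix units in `L(σ)` indexed by `α` comes from a factorization `σ = α ⊗ l`. -/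
theorem exists_unitary_of_matrixUnits {σ α : Type} [Fintype σ] [DecidableEq σ] [Fintype α]
    [DecidableEq α] [Nonempty α] (f : α → α → Matrix σ σ ℂ) (hstar : ∀ i j, (f i j)ᴴ = f j i)
    (hmul : ∀ i j k l, f i j * f k l = if j = k then f i l else 0) (hsum : ∑ i, f i i = 1) :
    ∃ (l : ℕ) (V : Matrix σ (α × Fin l) ℂ), IsUnitary V ∧
      ∀ i j a k, ∀ s, ∑ s', f i j s s' * V s' (a, k) = if j = a then V s (i, k) else 0 := by
  obtain ⟨o⟩ := ‹Nonempty α›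
  obtain ⟨l, K, hK, hKp⟩ := exists_isometry_of_projection (hstar o o) (by simp [hmul])
  have hVV : ∀ i j, (f i o * K)ᴴ * (f j o * K) = if i = j then 1 else 0 := by
    intro i j
    rw [Matrix.conjTranspose_mul, hstar, Matrix.mul_assoc, ← Matrix.mul_assoc (f o i), hmul]
    split_ifs
    · rw [← hKp, Matrix.mul_assoc, hK, Matrix.mul_one, hK]
    · simp
  refine ⟨l, Matrix.of fun s x => (f x.1 o * K) s x.2, ⟨?_, ?_⟩, ?_⟩
  · ext ⟨i, k⟩ ⟨j, k'⟩
    have h := congrFun (congrFun (hVV i j) k) k'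
    rw [Matrix.mul_apply] at h ⊢
    simp only [Matrix.conjTranspose_apply, Matrix.of_apply] at h ⊢
    rw [h]
    by_cases hij : i = j <;> simp [hij, Matrix.one_apply]
  · have h : ∑ i, (f i o * K) * (f i o * K)ᴴ = 1 := by
      rw [← hsum]
      refine Finset.sum_congr rfl fun i _ => ?_
      rw [Matrix.conjTranspose_mul, hstar, Matrix.mul_assoc, ← Matrix.mul_assoc K, hKp, hmul,
        if_pos rfl, hmul, if_pos rfl]
    ext s s'
    rw [← h, Matrix.mul_apply, Fintype.sum_prod_type, Matrix.sum_apply]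
    rfl
  · intro i j a k s
    have h : f i j * (f a o * K) = if j = a then f i o * K else 0 := by
      rw [← Matrix.mul_assoc, hmul]
      split_ifs <;> simp
    have h' := congrFun (congrFun h s) k
    rw [Matrix.mul_apply] at h'
    simp only [Matrix.of_apply]
    rw [h']
    split_ifs <;> rfl

/-- For `U : α ⊗ ζ → σ ⊗ τ`, the system `α` does not influence `τ`: the operators
`Uᴴ (1 ⊗ E) U` act trivially on `α`. -/
def ActsTrivially {σ τ α ζ : Type} [Fintype σ] [DecidableEq α]
    (U : Matrix (σ × τ) (α × ζ) ℂ) : Prop :=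
  ∃ m : τ → τ → ζ → ζ → ℂ, ∀ t t' a a' z z',
    ∑ s, U (s, t) (a, z) * star (U (s, t') (a', z')) = if a = a' then m t t' z z' else 0

section Factor

variable {σ τ α ζ : Type} [Fintype σ] [Fintype τ] [Fintype α] [Fintype ζ]
  [DecidableEq σ] [DecidableEq τ] [DecidableEq α] [DecidableEq ζ]

/-- An operator on `σ ⊗ τ` commuting with `1 ⊗ L(τ)` belongs to `L(σ) ⊗ 1`. -/
theorem exists_eq_kronecker_one [Nonempty τ] (A : Matrix (σ × τ) (σ × τ) ℂ)
    (h : ∀ t t', A * ((1 : Matrix σ σ ℂ) ⊗ₖ Matrix.single t t' 1) =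
      ((1 : Matrix σ σ ℂ) ⊗ₖ Matrix.single t t' 1) * A) :
    ∃ F : Matrix σ σ ℂ, A = F ⊗ₖ (1 : Matrix τ τ ℂ) := by
  obtain ⟨o⟩ := ‹Nonempty τ›
  refine ⟨Matrix.of fun s s' => A (s, o) (s', o), ?_⟩
  ext ⟨s, t⟩ ⟨s', t'⟩
  have key := congrFun (congrFun (h t' o) (s, t)) (s', o)
  simp only [Matrix.mul_apply, Fintype.sum_prod_type, Matrix.kroneckerMap_apply,
    Matrix.one_apply, Matrix.single_apply] at key
  simp only [Matrix.kroneckerMap_apply, Matrix.one_apply, Matrix.of_apply]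
  by_cases htt : t = t'
  · subst htt
    simpa using key
  · simpa [htt, Ne.symm htt] using key

theorem kronecker_one_injective {σ τ : Type} [DecidableEq τ] [Nonempty τ] {F G : Matrix σ σ ℂ}
    (h : F ⊗ₖ (1 : Matrix τ τ ℂ) = G ⊗ₖ (1 : Matrix τ τ ℂ)) : F = G := by
  obtain ⟨o⟩ := ‹Nonempty τ›
  ext s s'
  simpa using congrFun (congrFun h (s, o)) (s', o)

theorem ActsTrivially.exists_conj_eq [Nonempty τ] {U : Matrix (σ × τ) (α × ζ) ℂ}
    (hU : IsUnitary U) (h : ActsTrivially U) (X : Matrix α α ℂ) :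
    ∃ F : Matrix σ σ ℂ, U * (X ⊗ₖ (1 : Matrix ζ ζ ℂ)) * Uᴴ = F ⊗ₖ (1 : Matrix τ τ ℂ) := by
  obtain ⟨m, hm⟩ := h
  refine exists_eq_kronecker_one _ fun t t' => ?_
  set B : Matrix (σ × τ) (σ × τ) ℂ := (1 : Matrix σ σ ℂ) ⊗ₖ Matrix.single t t' 1 with hB
  set E : Matrix (α × ζ) (α × ζ) ℂ := X ⊗ₖ (1 : Matrix ζ ζ ℂ)
  set M : Matrix (α × ζ) (α × ζ) ℂ :=
    (1 : Matrix α α ℂ) ⊗ₖ (Matrix.of fun z' z => m t' t z z') with hM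
  have hUB : Uᴴ * B * U = M := by
    ext ⟨a', z'⟩ ⟨a, z⟩
    have := hm t' t a a' z z'
    simp only [hM, hB, Matrix.mul_apply, Fintype.sum_prod_type, Matrix.kroneckerMap_apply,
      Matrix.one_apply, Matrix.single_apply, Matrix.conjTranspose_apply, Matrix.of_apply]
    simp only [eq_comm (a := a') (b := a), ite_mul, one_mul, zero_mul, ← this]
    simp [mul_comm, ite_and]
  have hEM : E * M = M * E := by
    simp only [E, hM, ← Matrix.mul_kronecker_mul, Matrix.mul_one, Matrix.one_mul]
  calc U * E * Uᴴ * B = U * E * Uᴴ * B * (U * Uᴴ) := by rw [hU.2, Matrix.mul_one]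
    _ = U * (E * (Uᴴ * B * U)) * Uᴴ := by simp only [Matrix.mul_assoc]
    _ = U * ((Uᴴ * B * U) * E) * Uᴴ := by rw [hUB, hEM]
    _ = (U * Uᴴ) * B * (U * E * Uᴴ) := by simp only [Matrix.mul_assoc]
    _ = B * (U * E * Uᴴ) := by rw [hU.2, Matrix.one_mul]

/-- If `α` does not influence `τ` in `U : α ⊗ ζ → σ ⊗ τ`, then `U = (V ⊗ 1) (1 ⊗ Y)`. -/
theorem ActsTrivially.exists_factorization [Nonempty τ] [Nonempty α]
    {U : Matrix (σ × τ) (α × ζ) ℂ} (hU : IsUnitary U) (h : ActsTrivially U) :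
    ∃ (l : ℕ) (V : Matrix σ (α × Fin l) ℂ) (Y : Matrix (Fin l × τ) ζ ℂ),
      IsUnitary V ∧ IsUnitary Y ∧
      (∀ s t a z, U (s, t) (a, z) = ∑ k, V s (a, k) * Y (k, t) z) ∧
      (∀ k t a z, Y (k, t) z = ∑ s, star (V s (a, k)) * U (s, t) (a, z)) := by
  choose f hf using fun i j : α => h.exists_conj_eq hU (Matrix.single i j 1)
  have hstar : ∀ i j, (f i j)ᴴ = f j i := fun i j => kronecker_one_injective (τ := τ) (by
    rw [← hf j i, ← Matrix.conjTranspose_one (n := τ) (α := ℂ),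
      ← Matrix.conjTranspose_kronecker, ← hf i j]
    simp [Matrix.conjTranspose_mul, Matrix.mul_assoc, Matrix.conjTranspose_kronecker])
  obtain ⟨l, V, hV, hfV⟩ := exists_unitary_of_matrixUnits f hstar
    (fun i j k l => kronecker_one_injective (τ := τ) (by
      have : (f i j * f k l) ⊗ₖ (1 : Matrix τ τ ℂ) =
          U * ((Matrix.single i j 1 * Matrix.single k l 1) ⊗ₖ (1 : Matrix ζ ζ ℂ)) * Uᴴ := by
        rw [← Matrix.mul_one (1 : Matrix τ τ ℂ), Matrix.mul_kronecker_mul, ← hf, ← hf,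
          ← Matrix.mul_one (1 : Matrix ζ ζ ℂ), Matrix.mul_kronecker_mul, Matrix.mul_one]
        calc _ = U * (Matrix.single i j 1 ⊗ₖ (1 : Matrix ζ ζ ℂ)) * (Uᴴ * U) *
              (Matrix.single k l 1 ⊗ₖ (1 : Matrix ζ ζ ℂ)) * Uᴴ := by
              simp only [Matrix.mul_assoc]
          _ = _ := by rw [hU.1, Matrix.mul_one]; simp only [Matrix.mul_assoc]
      rw [this]
      split_ifs with hjk
      · subst hjk
        rw [Matrix.single_mul_single_same, mul_one, hf]
      · rw [Matrix.single_mul_single_of_ne _ _ _ _ hjk]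
        simp))
    (kronecker_one_injective (τ := τ) (by
      have : (∑ i, f i i) ⊗ₖ (1 : Matrix τ τ ℂ) = ∑ i, f i i ⊗ₖ (1 : Matrix τ τ ℂ) := by
        ext x y
        simp [Matrix.sum_apply, Finset.sum_mul]
      have h1 : ∑ i, (Matrix.single i i 1 : Matrix α α ℂ) ⊗ₖ (1 : Matrix ζ ζ ℂ) = 1 := by
        ext ⟨a, z⟩ ⟨a', z'⟩
        by_cases hz : z = z' <;>
          simp [Matrix.sum_apply, Matrix.single_apply, Matrix.one_apply, ite_and, hz]
      rw [this, Matrix.one_kronecker_one, ← hU.2]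
      simp only [← hf]
      rw [← Matrix.sum_mul, ← Matrix.mul_sum, h1, Matrix.mul_one]))
  have hU' : ∀ i j s t z, U (s, t) (i, z) = ∑ s', f i j s s' * U (s', t) (j, z) := by
    intro i j s t z
    have h1 : U * (Matrix.single i j 1 ⊗ₖ (1 : Matrix ζ ζ ℂ)) =
        (f i j ⊗ₖ (1 : Matrix τ τ ℂ)) * U := by
      rw [← hf, Matrix.mul_assoc _ Uᴴ, hU.1, Matrix.mul_one]
    have h2 := congrFun (congrFun h1 (s, t)) (j, z)
    simpa [Matrix.mul_apply, Fintype.sum_prod_type, Matrix.single_apply, Matrix.one_apply,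
      ite_and] using h2
  have hfV' : ∀ i j a k s', ∑ s, star (V s (a, k)) * f i j s s' =
      if i = a then star (V s' (j, k)) else 0 := by
    intro i j a k s'
    have h1 := congrArg star (hfV j i a k s')
    rw [star_sum, apply_ite star, star_zero] at h1
    rw [← h1]
    refine Finset.sum_congr rfl fun s _ => ?_
    rw [star_mul, ← hstar i j, Matrix.conjTranspose_apply, star_star]
  have hX : ∀ i j a k t z, ∑ s, star (V s (a, k)) * U (s, t) (i, z) =
      if i = a then ∑ s, star (V s (j, k)) * U (s, t) (j, z) else 0 := by
    intro i j a k t z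
    calc _ = ∑ s', (∑ s, star (V s (a, k)) * f i j s s') * U (s', t) (j, z) := by
          simp only [hU' i j, Finset.mul_sum, Finset.sum_mul, mul_assoc]
          exact Finset.sum_comm
      _ = _ := by
          simp only [hfV']
          split_ifs <;> simp
  obtain ⟨o⟩ := ‹Nonempty α›
  have hUV : ∀ s t a z, U (s, t) (a, z) =
      ∑ k, V s (a, k) * ∑ s', star (V s' (o, k)) * U (s', t) (o, z) := by
    intro s t a z
    have h1 : U (s, t) (a, z) = ∑ x, V s x * ∑ s', star (V s' x) * U (s', t) (a, z) := by
      have h2 : ∀ s', ∑ x, V s x * star (V s' x) = if s = s' then 1 else 0 := by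
        intro s'
        simpa [Matrix.mul_apply, Matrix.one_apply] using congrFun (congrFun hV.2 s) s'
      simp only [Finset.mul_sum, ← mul_assoc]
      rw [Finset.sum_comm]
      simp only [← Finset.sum_mul, h2]
      simp
    rw [h1, Fintype.sum_prod_type]
    simp only [hX a o]
    simp
  refine ⟨l, V, Matrix.of fun x z => ∑ s, star (V s (o, x.1)) * U (s, x.2) (o, z), hV, ?_, hUV,
    fun k t a z => by rw [hX a o a, if_pos rfl, Matrix.of_apply]⟩
  have := ((hV.kronecker (isUnitary_one (m := τ))).submatrix (Equiv.refl _)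
    (Equiv.prodAssoc α (Fin l) τ).symm).conjTranspose.mul hU
  refine isUnitary_of_one_kronecker (n' := α) ?_
  convert this
  ext ⟨a, k, t⟩ ⟨i, z⟩
  trans ∑ s, star (V s (a, k)) * U (s, t) (i, z)
  · rw [hX i o a]
    by_cases hia : i = a <;> simp [hia, eq_comm (a := a)]
  · simp [Matrix.mul_apply, Fintype.sum_prod_type, Matrix.one_apply, apply_ite]

variable {β : Type} [Fintype β] [DecidableEq β]

/-- If `α` does not influence `τ` and `β` does not influence `σ` in
`U : α ⊗ ζ ⊗ β → σ ⊗ τ`, then `U = (V ⊗ W) (1 ⊗ T ⊗ 1)`. -/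
theorem exists_eq_compVWT [Nonempty σ] [Nonempty τ] [Nonempty α] [Nonempty β]
    {U : Matrix (σ × τ) (α × (ζ × β)) ℂ} (hU : IsUnitary U) (hα : ActsTrivially U)
    (hβ : ActsTrivially (U.submatrix (fun x : τ × σ => (x.2, x.1))
      (fun x : β × (α × ζ) => (x.2.1, (x.2.2, x.1))))) :
    ∃ (l r : ℕ) (T : Matrix (Fin l × Fin r) ζ ℂ) (V : Matrix σ (α × Fin l) ℂ)
      (W : Matrix τ (Fin r × β) ℂ),
      IsUnitary T ∧ IsUnitary V ∧ IsUnitary W ∧ U = compVWT V W T := by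
  obtain ⟨l, V, Y, hV, hY, hUVY, hYU⟩ := hα.exists_factorization hU
  obtain ⟨o⟩ := ‹Nonempty α›
  have : Nonempty (Fin l) := by
    obtain ⟨s⟩ := ‹Nonempty σ›
    by_contra hl
    have := congrFun (congrFun hV.2 s) s
    rw [not_nonempty_iff] at hl
    simp [Matrix.mul_apply] at this
  have hY' := hY.submatrix (Equiv.prodComm τ (Fin l)) (Equiv.prodComm β ζ)
  have hβY : ActsTrivially (Y.submatrix (Equiv.prodComm τ (Fin l)) (Equiv.prodComm β ζ)) := by
    obtain ⟨m, hm⟩ := hβ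
    refine ⟨fun k k' z z' => ∑ s, ∑ s', star (V s (o, k)) * V s' (o, k') *
      m s s' (o, z) (o, z'), fun k k' b b' z z' => ?_⟩
    simp only [Matrix.submatrix_apply] at hm
    simp only [Matrix.submatrix_apply, Equiv.prodComm_apply, Prod.swap_prod_mk, hYU _ _ o]
    calc _ = ∑ s, ∑ s', star (V s (o, k)) * V s' (o, k') *
          ∑ t, U (s, t) (o, (z, b)) * star (U (s', t) (o, (z', b'))) := by
          simp only [star_sum, star_mul, star_star, Finset.sum_mul_sum]
          rw [Finset.sum_comm]
          refine Finset.sum_congr rfl fun s _ => ?_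
          rw [Finset.sum_comm]
          refine Finset.sum_congr rfl fun s' _ => ?_
          rw [Finset.mul_sum]
          exact Finset.sum_congr rfl fun t _ => by ring
      _ = _ := by
          simp only [fun s s' => hm s s' b b' (o, z) (o, z')]
          split_ifs <;> simp
  obtain ⟨r, W, T, hW, hT, hYWT, -⟩ := hβY.exists_factorization hY'
  refine ⟨l, r, T.submatrix (Equiv.prodComm _ _) (Equiv.refl _), V,
    W.submatrix (Equiv.refl _) (Equiv.prodComm _ _), hT.submatrix _ _, hV, hW.submatrix _ _, ?_⟩
  ext ⟨s, t⟩ ⟨a, z, b⟩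
  rw [hUVY]
  have h1 : ∀ k, Y (k, t) (z, b) = ∑ j, W t (b, j) * T (j, k) z := fun k => hYWT t k b z
  simp only [h1, compVWT, Matrix.mul_apply, Fintype.sum_prod_type, Matrix.submatrix_apply,
    regroup, Matrix.kroneckerMap_apply, Matrix.one_apply, Equiv.prodComm_apply,
    Equiv.refl_apply, Prod.swap_prod_mk, id]
  simp [Finset.mul_sum, mul_assoc]

end Factor

theorem choi_apply {m n : Type} [Fintype m] [Fintype n] [DecidableEq m]
    (Φ : Matrix m m ℂ →ₗ[ℂ] Matrix n n ℂ) (y y' : n) (x x' : m) :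
    choi Φ (y, x) (y', x') = Φ (Matrix.single x x' 1) y y' := by
  simp only [choi, Matrix.sum_apply, Matrix.kroneckerMap_apply, Matrix.single_apply]
  simp [ite_and]

theorem conjBy_single_apply {m n : Type} [Fintype m] [Fintype n] [DecidableEq m]
    (U : Matrix n m ℂ) (x x' : m) (y y' : n) :
    conjBy U (Matrix.single x x' 1) y y' = U y x * star (U y' x') := by
  simp [conjBy, Matrix.mul_apply, Matrix.single_apply, ite_and]

section Configurations

variable {ι κ : Type} [Fintype ι] [DecidableEq ι] [Fintype κ] [DecidableEq κ]
  {a : ι → ℕ} {b : κ → ℕ}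

/-- The operator with entries `G` is the identity on the systems in `P`, tensored with an operator
on the other systems. -/
def TrivialOn {ι : Type} {a : ι → ℕ} (P : Finset ι) (G : Cfg a → Cfg a → ℂ) : Prop :=
  (∀ x x', (∃ i ∈ P, x i ≠ x' i) → G x x' = 0) ∧
  ∀ x x' y y', (∀ i ∈ P, x i = x' i) → (∀ i ∈ P, y i = y' i) → (∀ i ∉ P, x i = y i) →
    (∀ i ∉ P, x' i = y' i) → G x x' = G y y'

theorem TrivialOn.of_singletons {ι : Type} [DecidableEq ι] {a : ι → ℕ} {P : Finset ι}
    {G : Cfg a → Cfg a → ℂ} (h : ∀ i ∈ P, TrivialOn {i} G) : TrivialOn P G := by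
  refine ⟨fun x x' ⟨i, hi, hne⟩ => (h i hi).1 x x' ⟨i, by simp, hne⟩, ?_⟩
  induction P using Finset.induction_on with
  | empty =>
    intro x x' y y' _ _ hxy hxy'
    rw [show x = y from funext fun i => hxy i (by simp),
      show x' = y' from funext fun i => hxy' i (by simp)]
  | insert i P hi ih =>
    intro x x' y y' hxx' hyy' hxy hxy'
    have hne : ∀ j ∈ P, j ≠ i := fun j hj hji => hi (hji ▸ hj)
    trans G (Function.update y i (x i)) (Function.update y' i (x' i))
    · refine ih (fun j hj => h j (Finset.mem_insert_of_mem hj)) x x' _ _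
        (fun j hj => hxx' j (Finset.mem_insert_of_mem hj)) (fun j hj => ?_) (fun j hj => ?_)
        (fun j hj => ?_)
      · simpa [Function.update_of_ne (hne j hj)] using hyy' j (Finset.mem_insert_of_mem hj)
      · rcases eq_or_ne j i with rfl | hji
        · simp
        · simpa [Function.update_of_ne hji] using hxy j (by simp [hji, hj])
      · rcases eq_or_ne j i with rfl | hji
        · simp
        · simpa [Function.update_of_ne hji] using hxy' j (by simp [hji, hj])
    · refine (h i (by simp)).2 _ _ y y' ?_ ?_ ?_ ?_
      · simpa using hxx' i (by simp)
      · simpa using hyy' i (by simp)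
      · intro j hj
        simp [Function.update_of_ne (by simpa using hj : j ≠ i)]
      · intro j hj
        simp [Function.update_of_ne (by simpa using hj : j ≠ i)]

theorem glue_res (P : Finset ι) (x : Cfg a) : glue P (res P x) (res Pᶜ x) = x := by
  funext i
  simp [glue, res]

theorem res_glue (P : Finset ι) (x : Cfg (sub a P)) (y : Cfg (sub a Pᶜ)) :
    res P (glue P x y) = x := by
  funext i
  simp [glue, res]

theorem res_compl_glue (P : Finset ι) (x : Cfg (sub a P)) (y : Cfg (sub a Pᶜ)) :
    res Pᶜ (glue P x y) = y := by
  funext i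
  simp [glue, res, Finset.mem_compl.1 i.2]

theorem NoInfluence.trivialOn {U : Matrix (Cfg b) (Cfg a) ℂ} {P : Finset ι} {Q R : Finset κ}
    (h : NoInfluence U P Q) (hR : R = Qᶜ) (g : Cfg (sub b R) → Cfg (sub b Q) → Cfg b)
    (hg : ∀ s t, res R (g s t) = s ∧ res Q (g s t) = t) (t t' : Cfg (sub b Q)) :
    TrivialOn P (fun x x' => ∑ s, U (g s t) x * star (U (g s t') x')) := by
  subst hR
  have hgg : ∀ s t, g s t = glue Q t s := fun s t => by
    rw [← glue_res Q (g s t), (hg s t).1, (hg s t).2]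
  obtain ⟨M, -, hM⟩ := h
  have key : ∀ x x', ∑ s, U (g s t) x * star (U (g s t') x') =
      choi M (t, res Pᶜ x) (t', res Pᶜ x') * if res P x = res P x' then 1 else 0 := by
    intro x x'
    have h1 := congrFun (congrFun hM (t, (res P x, res Pᶜ x))) (t', (res P x', res Pᶜ x'))
    simpa [choi_apply, conjBy_single_apply, glue_res, hgg, Matrix.one_apply] using h1
  refine ⟨fun x x' ⟨i, hi, hne⟩ => ?_, fun x x' y y' h1 h2 h3 h4 => ?_⟩
  · refine (key x x').trans ?_
    rw [if_neg fun heq => hne (congrFun heq ⟨i, hi⟩), mul_zero]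
  · simp only [key]
    rw [if_pos (show res P x = res P x' from funext fun i : P => h1 i i.2),
      if_pos (show res P y = res P y' from funext fun i : P => h2 i i.2),
      show res Pᶜ x = res Pᶜ y from funext fun i : ↥Pᶜ => h3 i (Finset.mem_compl.1 i.2),
      show res Pᶜ x' = res Pᶜ y' from funext fun i : ↥Pᶜ => h4 i (Finset.mem_compl.1 i.2)]

theorem NoInfluence.trivialOn_left {U : Matrix (Cfg b) (Cfg a) ℂ} {P : Finset ι} {S : Finset κ}
    (h : NoInfluence U P Sᶜ) (t t' : Cfg (sub b Sᶜ)) :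
    TrivialOn P (fun x x' => ∑ s, U (glue S s t) x * star (U (glue S s t') x')) :=
  h.trivialOn (compl_compl S).symm (glue S)
    (fun s t => ⟨res_glue S s t, res_compl_glue S s t⟩) t t'

theorem NoInfluence.trivialOn_right {U : Matrix (Cfg b) (Cfg a) ℂ} {P : Finset ι} {S : Finset κ}
    (h : NoInfluence U P S) (s s' : Cfg (sub b S)) :
    TrivialOn P (fun x x' => ∑ t, U (glue S s t) x * star (U (glue S s' t) x')) :=
  h.trivialOn rfl (fun t s => glue S s t)
    (fun t s => ⟨res_compl_glue S s t, res_glue S s t⟩) _ _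

/-- The identification `⨂ j, ℂ^(b j) = H_S ⊗ H_{Sᶜ}`. -/
def splitEquiv (b : κ → ℕ) (S : Finset κ) : Cfg b ≃ Cfg (sub b S) × Cfg (sub b Sᶜ) where
  toFun y := (res S y, res Sᶜ y)
  invFun z := glue S z.1 z.2
  left_inv y := glue_res S y
  right_inv z := Prod.ext (res_glue S z.1 z.2) (res_compl_glue S z.1 z.2)

/-- The identification of `⨂ i, ℂ^(a i)` with `H_P ⊗ H_C ⊗ H_Q` when the systems outside
`P ∪ C ∪ Q` are trivial. -/
def splitEquivThree (a : ι → ℕ) (ha : ∀ i, 0 < a i) (P C Q : Finset ι) (hPC : Disjoint P C)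
    (hPQ : Disjoint P Q) (hCQ : Disjoint C Q) (h1 : ∀ i, i ∉ P → i ∉ C → i ∉ Q → a i = 1) :
    Cfg a ≃ Cfg (sub a P) × (Cfg (sub a C) × Cfg (sub a Q)) where
  toFun x := (res P x, res C x, res Q x)
  invFun z i := if hP : i ∈ P then z.1 ⟨i, hP⟩ else if hC : i ∈ C then z.2.1 ⟨i, hC⟩ else
    if hQ : i ∈ Q then z.2.2 ⟨i, hQ⟩ else ⟨0, ha i⟩
  left_inv x := by
    funext i
    by_cases hP : i ∈ P
    · simp [hP, res]
    by_cases hC : i ∈ C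
    · simp [hP, hC, res]
    by_cases hQ : i ∈ Q
    · simp [hP, hC, hQ, res]
    · have := h1 i hP hC hQ
      ext
      simp only [hP, hC, hQ, dite_false]
      omega
  right_inv z := by
    refine Prod.ext (funext fun i => ?_) (Prod.ext (funext fun i => ?_) (funext fun i => ?_))
    · simp [res]
    · simp [res, Finset.disjoint_right.1 hPC i.2]
    · simp [res, Finset.disjoint_right.1 hPQ i.2, Finset.disjoint_right.1 hCQ i.2]

theorem exists_eq_compVWT_of_trivialOn (ha : ∀ i, 0 < a i) (hb : ∀ j, 0 < b j)
    {U : Matrix (Cfg b) (Cfg a) ℂ} (hU : IsUnitary U) (S : Finset κ) (P C Q : Finset ι)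
    (hPC : Disjoint P C) (hPQ : Disjoint P Q) (hCQ : Disjoint C Q)
    (h1 : ∀ i, i ∉ P → i ∉ C → i ∉ Q → a i = 1)
    (hP : ∀ t t', TrivialOn P (fun x x' => ∑ s, U (glue S s t) x * star (U (glue S s t') x')))
    (hQ : ∀ s s', TrivialOn Q (fun x x' => ∑ t, U (glue S s t) x * star (U (glue S s' t) x'))) :
    ∃ (l r : ℕ) (T : Matrix (Fin l × Fin r) (Cfg (sub a C)) ℂ)
      (V : Matrix (Cfg (sub b S)) (Cfg (sub a P) × Fin l) ℂ)
      (W : Matrix (Cfg (sub b Sᶜ)) (Fin r × Cfg (sub a Q)) ℂ),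
      IsUnitary T ∧ IsUnitary V ∧ IsUnitary W ∧
      U = (compVWT V W T).submatrix (fun y => (res S y, res Sᶜ y))
        (fun x => (res P x, res C x, res Q x)) := by
  have hne : ∀ R : Finset ι, Nonempty (Cfg (sub a R)) := fun R => ⟨fun i => ⟨0, ha i⟩⟩
  have hne' : ∀ R : Finset κ, Nonempty (Cfg (sub b R)) := fun R => ⟨fun i => ⟨0, hb i⟩⟩
  obtain ⟨p⟩ := hne P
  obtain ⟨q⟩ := hne Q
  set e := splitEquiv b S
  set f := splitEquivThree a ha P C Q hPC hPQ hCQ h1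
  have hsplit : ∀ i, i ∈ P ∨ i ∈ C ∨ i ∈ Q ∨ a i = 1 := fun i => by
    have := h1 i
    tauto
  have hfP : ∀ z i (hi : i ∈ P), f.symm z i = z.1 ⟨i, hi⟩ := fun z i hi =>
    congrFun (congrArg Prod.fst (f.apply_symm_apply z)) ⟨i, hi⟩
  have hfC : ∀ z i (hi : i ∈ C), f.symm z i = z.2.1 ⟨i, hi⟩ := fun z i hi =>
    congrFun (congrArg (fun w => w.2.1) (f.apply_symm_apply z)) ⟨i, hi⟩
  have hfQ : ∀ z i (hi : i ∈ Q), f.symm z i = z.2.2 ⟨i, hi⟩ := fun z i hi =>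
    congrFun (congrArg (fun w => w.2.2) (f.apply_symm_apply z)) ⟨i, hi⟩
  have hf1 : ∀ x x' : Cfg a, ∀ i, a i = 1 → x i = x' i := fun x x' i hi => by
    ext
    omega
  have hα : ActsTrivially (U.submatrix e.symm f.symm) := by
    refine ⟨fun t t' z z' => ∑ s, U (glue S s t) (f.symm (p, z)) *
      star (U (glue S s t') (f.symm (p, z'))), fun t t' x x' z z' => ?_⟩
    split_ifs with hxx
    · subst hxx
      refine (hP t t').2 _ _ _ _ (fun i hi => ?_) (fun i hi => ?_) (fun i hi => ?_)
        (fun i hi => ?_)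
      · rw [hfP _ _ hi, hfP _ _ hi]
      · rw [hfP _ _ hi, hfP _ _ hi]
      all_goals
        rcases hsplit i with h | h | h | h
        · exact absurd h hi
        · rw [hfC _ _ h, hfC _ _ h]
        · rw [hfQ _ _ h, hfQ _ _ h]
        · exact hf1 _ _ i h
    · obtain ⟨i, hi⟩ := Function.ne_iff.1 hxx
      exact (hP t t').1 _ _ ⟨i, i.2, by rwa [hfP _ _ i.2, hfP _ _ i.2]⟩
  have hβ : ActsTrivially ((U.submatrix e.symm f.symm).submatrix
      (fun x : Cfg (sub b Sᶜ) × Cfg (sub b S) => (x.2, x.1))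
      (fun x : Cfg (sub a Q) × (Cfg (sub a P) × Cfg (sub a C)) => (x.2.1, (x.2.2, x.1)))) := by
    refine ⟨fun s s' z z' => ∑ t, U (glue S s t) (f.symm (z.1, (z.2, q))) *
      star (U (glue S s' t) (f.symm (z'.1, (z'.2, q)))), fun s s' x x' z z' => ?_⟩
    split_ifs with hxx
    · subst hxx
      refine (hQ s s').2 _ _ _ _ (fun i hi => ?_) (fun i hi => ?_) (fun i hi => ?_)
        (fun i hi => ?_)
      · rw [hfQ _ _ hi, hfQ _ _ hi]
      · rw [hfQ _ _ hi, hfQ _ _ hi]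
      all_goals
        rcases hsplit i with h | h | h | h
        · rw [hfP _ _ h, hfP _ _ h]
        · rw [hfC _ _ h, hfC _ _ h]
        · exact absurd h hi
        · exact hf1 _ _ i h
    · obtain ⟨i, hi⟩ := Function.ne_iff.1 hxx
      exact (hQ s s').1 _ _ ⟨i, i.2, by rwa [hfQ _ _ i.2, hfQ _ _ i.2]⟩
  have := hne' S
  have := hne' Sᶜ
  have : Nonempty (Cfg (sub a P)) := ⟨p⟩
  have : Nonempty (Cfg (sub a Q)) := ⟨q⟩
  obtain ⟨l, r, T, V, W, hT, hV, hW, h⟩ :=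
    exists_eq_compVWT (hU.submatrix e.symm f.symm) hα hβ
  refine ⟨l, r, T, V, W, hT, hV, hW, ?_⟩
  rw [← h]
  ext y x
  change U y x = U (e.symm (e y)) (f.symm (f x))
  simp

end Configurations

/-- A property of the input that influences neither of the two outputs is constant. -/
theorem eq_of_no_influence {σ τ X ρ : Type} [Fintype σ] [Fintype τ] [Fintype X] [DecidableEq σ]
    [DecidableEq τ] [DecidableEq X] {U : Matrix (σ × τ) X ℂ} (hU : IsUnitary U) (f : X → ρ)
    (hτ : ∀ t t' x x', f x ≠ f x' → ∑ s, U (s, t) x * star (U (s, t') x') = 0)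
    (hσ : ∀ s s' x x', f x ≠ f x' → ∑ t, U (s, t) x * star (U (s', t) x') = 0) (x x' : X) :
    f x = f x' := by
  by_contra hne
  have hrow : ∀ y y', ∑ w, U y w * star (U y' w) = if y = y' then 1 else 0 := fun y y' => by
    simpa [Matrix.mul_apply, Matrix.one_apply] using congrFun (congrFun hU.2 y) y'
  have hcol : ∀ w, ∑ y, star (U y w) * U y w = 1 := fun w => by
    simpa [Matrix.mul_apply, Matrix.one_apply] using congrFun (congrFun hU.1 w) w
  have hzero : ∀ y y', star (U y x) * U y' x' = 0 := by
    rintro ⟨s, t⟩ ⟨s', t'⟩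
    have h1 : ∑ w, (∑ t₁, U (s', t₁) w * star (U (s, t₁) x)) *
        (∑ s₁, U (s₁, t') x' * star (U (s₁, t) w)) = 0 := by
      refine Finset.sum_eq_zero fun w _ => ?_
      by_cases hw : f w = f x
      · rw [hτ _ _ _ _ (fun h => hne (hw ▸ h.symm)), mul_zero]
      · rw [hσ _ _ _ _ hw, zero_mul]
    have h2 : ∑ w, (∑ t₁, U (s', t₁) w * star (U (s, t₁) x)) *
        (∑ s₁, U (s₁, t') x' * star (U (s₁, t) w)) =
        ∑ t₁, ∑ s₁, star (U (s, t₁) x) * U (s₁, t') x' *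
          ∑ w, U (s', t₁) w * star (U (s₁, t) w) := by
      simp only [Finset.sum_mul_sum]
      rw [Finset.sum_comm]
      refine Finset.sum_congr rfl fun t₁ _ => ?_
      rw [Finset.sum_comm]
      refine Finset.sum_congr rfl fun s₁ _ => ?_
      rw [Finset.mul_sum]
      exact Finset.sum_congr rfl fun w _ => by ring
    rw [h2] at h1
    simp only [hrow] at h1
    simpa [ite_and] using h1
  have : (∑ y, star (U y x) * U y x) * ∑ y, star (U y x') * U y x' = 0 := by
    rw [Finset.sum_mul_sum]
    refine Finset.sum_eq_zero fun y _ => Finset.sum_eq_zero fun y' _ => ?_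
    linear_combination (U y x * star (U y' x')) * hzero y y'
  rw [hcol, hcol] at this
  simp at this

theorem dim_eq_one_of_noInfluence {ι κ : Type} [Fintype ι] [DecidableEq ι] [Fintype κ]
    [DecidableEq κ] {a : ι → ℕ} {b : κ → ℕ} (ha : ∀ i, 0 < a i) {U : Matrix (Cfg b) (Cfg a) ℂ}
    (hU : IsUnitary U) {i : ι} {S : Finset κ} (h1 : NoInfluence U {i} S)
    (h2 : NoInfluence U {i} Sᶜ) : a i = 1 := by
  by_contra hne
  have h := eq_of_no_influence (hU.submatrix (splitEquiv b S).symm (Equiv.refl _))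
    (fun x : Cfg a => x i)
    (fun t t' x x' hxx => (h2.trivialOn_left t t').1 x x' ⟨i, by simp, hxx⟩)
    (fun s s' x x' hxx => (h1.trivialOn_right s s').1 x x' ⟨i, by simp, hxx⟩)
    (fun j => ⟨0, ha j⟩)
    (Function.update (fun j => ⟨0, ha j⟩) i ⟨1, by have := ha i; omega⟩)
  simp at h

section Bare

variable {a b : Wires} (e : b.label ≃ a.label) (h : ∀ j, b.dim j = a.dim (e j))

theorem mul_toMatrix_bare {m : Type} (M : Matrix m (Cfg b.dim) ℂ) :
    M * (Circuit.bare e h).toMatrix =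
      M.submatrix id (fun x j => Fin.cast (h j).symm (x (e j))) := by
  ext y x
  simp only [Matrix.mul_apply, Circuit.toMatrix, Matrix.of_apply, Matrix.submatrix_apply, id]
  rw [Finset.sum_eq_single (fun j => Fin.cast (h j).symm (x (e j)))]
  · simp
  · intro w _ hw
    rw [if_neg, mul_zero]
    exact fun hw' => hw (funext fun j => Fin.ext (hw' j))
  · simp

theorem toMatrix_bare_mul {m : Type} (M : Matrix (Cfg a.dim) m ℂ) :
    (Circuit.bare e h).toMatrix * M =
      M.submatrix (fun y i => Fin.cast ((h _).trans (congrArg a.dim (e.apply_symm_apply i)))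
        (y (e.symm i))) id := by
  ext y x
  simp only [Matrix.mul_apply, Circuit.toMatrix, Matrix.of_apply, Matrix.submatrix_apply, id]
  rw [Finset.sum_eq_single (fun i => Fin.cast ((h _).trans
    (congrArg a.dim (e.apply_symm_apply i))) (y (e.symm i)))]
  · rw [if_pos, one_mul]
    intro j
    simp only [Fin.val_cast]
    rw [e.symm_apply_apply]
  · intro w _ hw
    rw [if_neg, zero_mul]
    refine fun hw' => hw (funext fun i => Fin.ext ?_)
    have := hw' (e.symm i)
    rw [e.apply_symm_apply] at this
    exact this.symm
  · simp

end Bare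

/-- The wires carrying the systems of a subfamily. -/
abbrev subWires {ι : Type} [DecidableEq ι] (a : ι → ℕ) (P : Finset ι) : Wires := ⟨P, sub a P⟩

/-- A single wire. -/
abbrev oneWire (l : ℕ) : Wires := ⟨Unit, fun _ => l⟩

/-- No wire at all. -/
abbrev noWire : Wires := ⟨Empty, Empty.elim⟩

/-- The product basis of two bundles of wires side by side. -/
def parEquiv {p q : Type} (d : p → ℕ) (d' : q → ℕ) :
    Cfg (Sum.elim d d') ≃ Cfg d × Cfg d' where
  toFun x := (fun i => x (Sum.inl i), fun i => x (Sum.inr i))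
  invFun z := fun
    | Sum.inl i => z.1 i
    | Sum.inr i => z.2 i
  left_inv x := by funext i; cases i <;> rfl
  right_inv _ := rfl

/-- The basis of a single wire. -/
def oneEquiv (l : ℕ) : Cfg (fun _ : Unit => l) ≃ Fin l where
  toFun x := x ()
  invFun k := fun _ => k
  left_inv _ := rfl
  right_inv _ := rfl

/-- Rearranging the wires between the first and the second layer of boxes. -/
def regroupWires (p l r q : Type) : (p ⊕ l) ⊕ (r ⊕ q) ≃ Empty ⊕ (p ⊕ ((l ⊕ r) ⊕ q)) where
  toFun
    | .inl (.inl i) => .inr (.inl i)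
    | .inl (.inr i) => .inr (.inr (.inl (.inl i)))
    | .inr (.inl i) => .inr (.inr (.inl (.inr i)))
    | .inr (.inr i) => .inr (.inr (.inr i))
  invFun
    | .inr (.inl i) => .inl (.inl i)
    | .inr (.inr (.inl (.inl i))) => .inl (.inr i)
    | .inr (.inr (.inl (.inr i))) => .inr (.inl i)
    | .inr (.inr (.inr i)) => .inr (.inr i)
  left_inv x := by rcases x with (_ | _) | (_ | _) <;> rfl
  right_inv x := by rcases x with ⟨⟨⟩⟩ | _ | (_ | _) | _ <;> rfl

/-- Basis labels of the wires between the two layers of boxes. -/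
def middleEquiv {p q : Type} (d : p → ℕ) (d' : q → ℕ) (l r : ℕ) :
    Cfg (Sum.elim noWire.dim (Sum.elim d (Sum.elim (Sum.elim (oneWire l).dim (oneWire r).dim) d'))) ≃
      (Cfg d × Fin l) × (Fin r × Cfg d') where
  toFun z := ((fun i => z (.inr (.inl i)), z (.inr (.inr (.inl (.inl ()))))),
    (z (.inr (.inr (.inl (.inr ())))), fun i => z (.inr (.inr (.inr i)))))
  invFun w := fun
    | .inr (.inl i) => w.1.1 i
    | .inr (.inr (.inl (.inl _))) => w.1.2
    | .inr (.inr (.inl (.inr _))) => w.2.1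
    | .inr (.inr (.inr i)) => w.2.2 i
  left_inv z := by funext i; rcases i with ⟨⟨⟩⟩ | _ | (_ | _) | _ <;> rfl
  right_inv _ := rfl

section Layered

variable {ι κ : Type} [Fintype ι] [DecidableEq ι] [Fintype κ] [DecidableEq κ]

theorem bijective_sumElim_val_compl (S : Finset κ) :
    Function.Bijective (Sum.elim (fun j : S => j.1) (fun j : ↥Sᶜ => j.1)) := by
  constructor
  · rintro (⟨i, hi⟩ | ⟨i, hi⟩) (⟨j, hj⟩ | ⟨j, hj⟩) h <;> simp at h hi hj ⊢ <;> grind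
  · intro j
    by_cases hj : j ∈ S
    · exact ⟨.inl ⟨j, hj⟩, rfl⟩
    · exact ⟨.inr ⟨j, Finset.mem_compl.2 hj⟩, rfl⟩

/-- The circuit `(V ⊗ W) (1 ⊗ T ⊗ 1)`, in which the trivial systems in `N` are discarded. -/
theorem exists_layered_circuit {a : ι → ℕ} {b : κ → ℕ} (S : Finset κ) (N P C Q : Finset ι)
    (he : Function.Bijective (Sum.elim (fun i : N => i.1) (Sum.elim (fun i : P => i.1)
      (Sum.elim (fun i : C => i.1) (fun i : Q => i.1)))))
    (hN : ∀ i ∈ N, a i = 1) {l r : ℕ} {T : Matrix (Fin l × Fin r) (Cfg (sub a C)) ℂ}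
    {V : Matrix (Cfg (sub b S)) (Cfg (sub a P) × Fin l) ℂ}
    {W : Matrix (Cfg (sub b Sᶜ)) (Fin r × Cfg (sub a Q)) ℂ}
    (hT : IsUnitary T) (hV : IsUnitary V) (hW : IsUnitary W) :
    ∃ c : Circuit ⟨ι, a⟩ ⟨κ, b⟩,
      c.toMatrix = (compVWT V W T).submatrix (fun y => (res S y, res Sᶜ y))
        (fun x => (res P x, res C x, res Q x)) ∧
      ∀ i j, c.HasPath i j ↔ (j ∈ S ∧ (i ∈ P ∨ i ∈ C)) ∨ (j ∉ S ∧ (i ∈ C ∨ i ∈ Q)) := by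
  let e₀ := Equiv.ofBijective _ he
  let e₁ := (Equiv.ofBijective _ (bijective_sumElim_val_compl S)).symm
  let trivialEquiv : Cfg (sub a N) ≃ Cfg noWire.dim :=
    { toFun := fun _ i => i.elim
      invFun := fun _ i => ⟨0, by simp [hN i i.2]⟩
      left_inv := fun x => by
        funext i
        ext
        have h1 := hN i i.2
        have h2 := (x i).2
        simp only [sub] at h2 ⊢
        omega
      right_inv := fun x => by funext i; exact i.elim }
  let boxN : Circuit (subWires a N) noWire :=
    .box _ (isUnitary_one.submatrix (Equiv.refl _) trivialEquiv)
  let boxP : Circuit (subWires a P) (subWires a P) := .box _ isUnitary_one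
  let boxQ : Circuit (subWires a Q) (subWires a Q) := .box _ isUnitary_one
  let boxT : Circuit (subWires a C) ((oneWire l).par (oneWire r)) :=
    .box _ (hT.submatrix ((parEquiv _ _).trans ((oneEquiv l).prodCongr (oneEquiv r)))
      (Equiv.refl _))
  let boxV : Circuit ((subWires a P).par (oneWire l)) (subWires b S) :=
    .box _ (hV.submatrix (Equiv.refl _)
      ((parEquiv _ _).trans ((Equiv.refl _).prodCongr (oneEquiv l))))
  let boxW : Circuit ((oneWire r).par (subWires a Q)) (subWires b Sᶜ) :=
    .box _ (hW.submatrix (Equiv.refl _)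
      ((parEquiv _ _).trans ((oneEquiv r).prodCongr (Equiv.refl _))))
  let first : Circuit ⟨ι, a⟩ ((subWires a N).par ((subWires a P).par
      ((subWires a C).par (subWires a Q)))) :=
    .bare e₀ (by rintro (_ | _ | _ | _) <;> rfl)
  let middle : Circuit (noWire.par ((subWires a P).par
      (((oneWire l).par (oneWire r)).par (subWires a Q))))
      (((subWires a P).par (oneWire l)).par ((oneWire r).par (subWires a Q))) :=
    .bare (regroupWires _ _ _ _) (by rintro ((_ | _) | (_ | _)) <;> rfl)
  let last : Circuit ((subWires b S).par (subWires b Sᶜ)) ⟨κ, b⟩ :=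
    .bare e₁ (fun j => by
      obtain ⟨z, rfl⟩ := e₁.symm.surjective j
      rw [e₁.apply_symm_apply]
      cases z <;> rfl)
  refine ⟨.seq first (.seq (.par boxN (.par boxP (.par boxT boxQ)))
    (.seq middle (.seq (.par boxV boxW) last))), ?_, ?_⟩
  · change last.toMatrix * (Circuit.par boxV boxW).toMatrix * middle.toMatrix *
      (Circuit.par boxN (.par boxP (.par boxT boxQ))).toMatrix * first.toMatrix = _
    rw [mul_toMatrix_bare, mul_toMatrix_bare, toMatrix_bare_mul]
    trans (V ⊗ₖ W).submatrix (fun y : Cfg b => (res S y, res Sᶜ y)) (middleEquiv _ _ l r) *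
      (((1 : Matrix (Cfg (sub a P)) _ ℂ) ⊗ₖ (T ⊗ₖ (1 : Matrix (Cfg (sub a Q)) _ ℂ))).submatrix
        regroup id).submatrix (middleEquiv _ _ l r)
        (fun x : Cfg a => (res P x, res C x, res Q x))
    · ext y x
      refine Finset.sum_congr rfl fun z _ => congrArg₂ (· * ·) rfl ?_
      change (1 : Matrix (Cfg noWire.dim) (Cfg noWire.dim) ℂ) (fun i => z (Sum.inl i))
        (trivialEquiv fun i => x i) * _ = _
      rw [show (fun i => z (Sum.inl i)) = trivialEquiv fun i => x i from
        funext fun i => Empty.elim i, Matrix.one_apply_eq, one_mul]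
      rfl
    · rw [Matrix.submatrix_mul_equiv, compVWT]
  · intro i j
    obtain ⟨i, rfl⟩ := e₀.surjective i
    obtain ⟨j, rfl⟩ := e₁.symm.surjective j
    have hPath : (Circuit.seq first (.seq (.par boxN (.par boxP (.par boxT boxQ)))
        (.seq middle (.seq (.par boxV boxW) last)))).HasPath (e₀ i) (e₁.symm j) ↔
        ∃ k, (Circuit.par boxN (.par boxP (.par boxT boxQ))).HasPath i
          (regroupWires _ _ _ _ k) ∧ (Circuit.par boxV boxW).HasPath k j := by
      constructor
      · rintro ⟨k₀, h₀, k₁, h₁, k₂, h₂, k₃, h₃, h₄⟩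
        obtain rfl := e₀.injective h₀
        obtain rfl : _ = k₁ := h₂
        obtain rfl : j = k₃ := (e₁.apply_symm_apply j).symm.trans h₄
        exact ⟨k₂, h₁, h₃⟩
      · rintro ⟨k, h₁, h₃⟩
        exact ⟨i, rfl, _, h₁, k, rfl, j, h₃, e₁.apply_symm_apply j⟩
    have hmP : e₀ i ∈ P ↔ ∃ p, i = .inr (.inl p) :=
      ⟨fun h => ⟨⟨_, h⟩, e₀.injective rfl⟩, by rintro ⟨p, rfl⟩; exact p.2⟩
    have hmC : e₀ i ∈ C ↔ ∃ p, i = .inr (.inr (.inl p)) :=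
      ⟨fun h => ⟨⟨_, h⟩, e₀.injective rfl⟩, by rintro ⟨p, rfl⟩; exact p.2⟩
    have hmQ : e₀ i ∈ Q ↔ ∃ p, i = .inr (.inr (.inr p)) :=
      ⟨fun h => ⟨⟨_, h⟩, e₀.injective rfl⟩, by rintro ⟨p, rfl⟩; exact p.2⟩
    have hmS : e₁.symm j ∈ S ↔ ∃ s, j = .inl s :=
      ⟨fun h => ⟨⟨_, h⟩, e₁.symm.injective rfl⟩, by rintro ⟨s, rfl⟩; exact s.2⟩
    rw [hPath, hmP, hmC, hmQ, hmS, Sum.exists, Sum.exists, Sum.exists]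
    rcases i with i | i | i | i <;> rcases j with j | j <;>
      simp [regroupWires, Circuit.HasPath, boxN, boxP, boxT, boxQ, boxV, boxW]
    all_goals exact ⟨i, i.2⟩

end Layered

theorem exists_causallyFaithful_circuit {ι : Type} [Fintype ι] [DecidableEq ι] {a : ι → ℕ}
    {b : Fin 2 → ℕ} (ha : ∀ i, 0 < a i) (hb : ∀ j, 0 < b j) {U : Matrix (Cfg b) (Cfg a) ℂ}
    (hU : IsUnitary U) :
    ∃ c : Circuit ⟨ι, a⟩ ⟨Fin 2, b⟩, c.toMatrix = U ∧ c.CausallyFaithful := by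
  classical
  have hcompl : ({0} : Finset (Fin 2))ᶜ = {1} := by decide
  let N := Finset.univ.filter fun i => NoInfluence U {i} {0} ∧ NoInfluence U {i} {1}
  let P := Finset.univ.filter fun i => ¬ NoInfluence U {i} {0} ∧ NoInfluence U {i} {1}
  let C := Finset.univ.filter fun i => ¬ NoInfluence U {i} {0} ∧ ¬ NoInfluence U {i} {1}
  let Q := Finset.univ.filter fun i => NoInfluence U {i} {0} ∧ ¬ NoInfluence U {i} {1}
  have hmN : ∀ i, i ∈ N ↔ NoInfluence U {i} {0} ∧ NoInfluence U {i} {1} := by simp [N]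
  have hmP : ∀ i, i ∈ P ↔ ¬ NoInfluence U {i} {0} ∧ NoInfluence U {i} {1} := by simp [P]
  have hmC : ∀ i, i ∈ C ↔ ¬ NoInfluence U {i} {0} ∧ ¬ NoInfluence U {i} {1} := by simp [C]
  have hmQ : ∀ i, i ∈ Q ↔ NoInfluence U {i} {0} ∧ ¬ NoInfluence U {i} {1} := by simp [Q]
  have hN : ∀ i ∈ N, a i = 1 := fun i hi =>
    dim_eq_one_of_noInfluence ha hU ((hmN i).1 hi).1 (hcompl ▸ ((hmN i).1 hi).2)
  obtain ⟨l, r, T, V, W, hT, hV, hW, hUc⟩ :=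
    exists_eq_compVWT_of_trivialOn ha hb hU {0} P C Q
      (Finset.disjoint_left.2 fun i h h' => ((hmC i).1 h').2 ((hmP i).1 h).2)
      (Finset.disjoint_left.2 fun i h h' => ((hmQ i).1 h').2 ((hmP i).1 h).2)
      (Finset.disjoint_left.2 fun i h h' => ((hmC i).1 h).1 ((hmQ i).1 h').1)
      (fun i h₁ h₂ h₃ => hN i (by rw [hmP] at h₁; rw [hmC] at h₂; rw [hmQ] at h₃; rw [hmN]; tauto))
      (fun t t' => TrivialOn.of_singletons fun i hi =>
        NoInfluence.trivialOn_left (hcompl ▸ ((hmP i).1 hi).2) t t')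
      (fun s s' => TrivialOn.of_singletons fun i hi =>
        NoInfluence.trivialOn_right ((hmQ i).1 hi).1 s s')
  have he : Function.Bijective (Sum.elim (fun i : N => i.1) (Sum.elim (fun i : P => i.1)
      (Sum.elim (fun i : C => i.1) (fun i : Q => i.1)))) := by
    constructor
    · rintro (⟨i, hi⟩ | ⟨i, hi⟩ | ⟨i, hi⟩ | ⟨i, hi⟩) (⟨j, hj⟩ | ⟨j, hj⟩ | ⟨j, hj⟩ | ⟨j, hj⟩) h <;>
        obtain rfl : i = j := h <;> first | rfl | skip
      all_goals
        simp only [hmN, hmP, hmC, hmQ] at hi hj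
        tauto
    · intro i
      by_cases h₀ : NoInfluence U {i} {0} <;> by_cases h₁ : NoInfluence U {i} {1}
      · exact ⟨.inl ⟨i, (hmN i).2 ⟨h₀, h₁⟩⟩, rfl⟩
      · exact ⟨.inr (.inr (.inr ⟨i, (hmQ i).2 ⟨h₀, h₁⟩⟩)), rfl⟩
      · exact ⟨.inr (.inl ⟨i, (hmP i).2 ⟨h₀, h₁⟩⟩), rfl⟩
      · exact ⟨.inr (.inr (.inl ⟨i, (hmC i).2 ⟨h₀, h₁⟩⟩)), rfl⟩
  obtain ⟨c, hc, hpath⟩ := exists_layered_circuit {0} N P C Q he hN hT hV hW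
  rw [← hUc] at hc
  refine ⟨c, hc, fun i j => ?_⟩
  rw [hc, hpath, hmP, hmC, hmQ]
  have htwo : ∀ j : Fin 2, j = 0 ∨ j = 1 := by decide
  rcases htwo j with rfl | rfl
  · simp only [Finset.mem_singleton, not_true_eq_false, true_and, false_and, or_false]
    tauto
  · simp only [Finset.mem_singleton, one_ne_zero, not_false_eq_true, true_and, false_and,
      false_or]
    tauto

end UnitaryCausality

theorem theorem4 :
    (∀ (n k : ℕ) (dA : Fin n → ℕ) (dB : Fin k → ℕ), (∀ i, 0 < dA i) → (∀ j, 0 < dB j) →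
      ∀ U : Matrix (Cfg dB) (Cfg dA) ℂ, IsUnitary U →
      ∀ (S : Finset (Fin k)) (P C Q : Finset (Fin n)),
        Disjoint P C → Disjoint P Q → Disjoint C Q → P ∪ C ∪ Q = Finset.univ →
        NoInfluence U P Sᶜ → NoInfluence U Q S →
        ∃ (l r : ℕ) (T : Matrix (Fin l × Fin r) (Cfg (sub dA C)) ℂ)
          (V : Matrix (Cfg (sub dB S)) (Cfg (sub dA P) × Fin l) ℂ)
          (W : Matrix (Cfg (sub dB Sᶜ)) (Fin r × Cfg (sub dA Q)) ℂ),
          IsUnitary T ∧ IsUnitary V ∧ IsUnitary W ∧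
          U = (compVWT V W T).submatrix (fun y => (res S y, res Sᶜ y))
            (fun x => (res P x, res C x, res Q x))) ∧
    (∀ (n : ℕ) (dA : Fin n → ℕ) (dB : Fin 2 → ℕ), (∀ i, 0 < dA i) → (∀ j, 0 < dB j) →
      ∀ U : Matrix (Cfg dB) (Cfg dA) ℂ, IsUnitary U →
        ∃ c : Circuit ⟨Fin n, dA⟩ ⟨Fin 2, dB⟩, c.toMatrix = U ∧ c.CausallyFaithful) := by
  refine ⟨fun n k dA dB hA hB U hU S P C Q hPC hPQ hCQ huniv hP hQ => ?_,
    fun n dA dB hA hB U hU => exists_causallyFaithful_circuit hA hB hU⟩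
  refine exists_eq_compVWT_of_trivialOn hA hB hU S P C Q hPC hPQ hCQ (fun i h₁ h₂ h₃ => ?_)
    hP.trivialOn_left hQ.trivialOn_right
  have hi : i ∈ P ∪ C ∪ Q := huniv ▸ Finset.mem_univ i
  simp [h₁, h₂, h₃] at hi
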